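/- Let $\zeta^{(k)}$ denote the $k$-th derivative of the Riemann zeta function (meromorphically continued to $\mathbb{C}$). For every positive integer $k$ and every $a\in\mathbb{C}$ there exists a positive integer $N=N_k(a)$ such that for every integer $n\ge N$ the equation $\zeta^{(k)}(s)=a$ has exactly one root, counted with multiplicity, in the open box $$\mathcal{C}_n=\{s\in\mathbb{C} : -2n-1<\operatorname{Re} s<-2n+1,\ -1<\operatorname{Im} s<1\};$$ that is, there is exactly one $s\in\mathcal{C}_n$ with $\zeta^{(k)}(s)=a$, and it is a simple zero of $\zeta^{(k)}-a$. (These roots are called the trivial $a$-points of $\zeta^{(k)}$.) -/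

import Mathlib

/-- The open box `{s : -2n-1 < Re s < -2n+1, -1 < Im s < 1}` in the complex plane. -/
def zetaBox (n : ℕ) : Set ℂ :=
  {s : ℂ | -2 * (n : ℝ) - 1 < s.re ∧ s.re < -2 * (n : ℝ) + 1 ∧ -1 < s.im ∧ s.im < 1}

/-- The `k`-th complex derivative of the Riemann zeta function. -/
noncomputable def zetaDeriv (k : ℕ) : ℂ → ℂ := iteratedDeriv k riemannZeta

/-- `f s = a` has exactly one root in `U`, counted with multiplicity: there is a root in `U`,
it is simple (`f - a` is analytic with vanishing order exactly `1` there), and every root in `U`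
is equal to it. -/
def HasExactlyOneRoot (f : ℂ → ℂ) (a : ℂ) (U : Set ℂ) : Prop :=
  ∃ s ∈ U, f s = a ∧ AnalyticAt ℂ f s ∧ analyticOrderAt (fun z => f z - a) s = 1 ∧
    ∀ z ∈ U, f z = a → z = s

open Filter Topology Metric Set

/-! Put `s = -2n + v` with `|v| < 2`. The functional equation reads `ζ(-2n+v) = P_n(v) ζ(2n+1-v)
sin(πv/2)`, where `P_n = reflFactor n` has no zeros and `ζ(2n+1-v) → 1` uniformly. The logarithmic
derivative of `P_n` stays within a bounded distance of `c_n = -H_n` (minus the harmonic number), and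
`|c_n| → ∞`. Each differentiation therefore acts, to leading order, as multiplication by `c_n`, so
`ζ^(k)(-2n+v) = P_n(v) c_n^k G_n(v)` with `G_n → sin(πv/2)` still
(`exists_iteratedDeriv_eq_mul_pow_mul`).

Since `|P_n|` grows at least geometrically, `a / (P_n c_n^k) → 0`; hence `ζ^(k) - a` is a zero-free
factor times some `h_n → sin(πv/2)` (`exists_zetaDeriv_sub_factorization`). The only zero of the
limit in the closed square is the simple one at `0`, and a Hurwitz-type argument
(`eventually_existsUnique_simple_zero`) carries this over to `h_n`. -/

/-! ### Two limit principles for sequences of holomorphic functions. -/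

theorem exists_iteratedDeriv_eq_mul_pow_mul {U : Set ℂ} (hU : IsOpen U)
    {f P g : ℕ → ℂ → ℂ} {c : ℕ → ℂ} {S : ℂ → ℂ}
    (hP : ∀ᶠ n in atTop, DifferentiableOn ℂ (P n) U)
    (hP0 : ∀ᶠ n in atTop, ∀ z ∈ U, P n z ≠ 0)
    (hc : Tendsto (fun n => (c n)⁻¹) atTop (𝓝 0)) (hc0 : ∀ᶠ n in atTop, c n ≠ 0)
    (hlog : TendstoLocallyUniformlyOn (fun n z => logDeriv (P n) z / c n) 1 atTop U)
    (hf : ∀ᶠ n in atTop, EqOn (f n) (fun z => P n z * g n z) U)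
    (hg : ∀ᶠ n in atTop, DifferentiableOn ℂ (g n) U)
    (hgS : TendstoLocallyUniformlyOn g S atTop U) (k : ℕ) :
    ∃ G : ℕ → ℂ → ℂ, (∀ᶠ n in atTop, DifferentiableOn ℂ (G n) U) ∧
      TendstoLocallyUniformlyOn G S atTop U ∧
      ∀ᶠ n in atTop, EqOn (iteratedDeriv k (f n)) (fun z => P n z * c n ^ k * G n z) U := by
  induction k with
  | zero =>
    refine ⟨g, hg, hgS, ?_⟩
    filter_upwards [hf] with n hn z hz
    simpa using hn hz
  | succ k ih =>
    obtain ⟨G, hG, hGS, hGf⟩ := ih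
    have hS : DifferentiableOn ℂ S U := hGS.differentiableOn hG hU
    have hG' := hGS.deriv hG hU
    -- From `(P c^k G)' = P c^(k+1) ((P'/P)/c · G + G'/c)`; the bracket tends to `1 · S + 0 · S'`.
    refine ⟨fun n z => logDeriv (P n) z / c n * G n z + (c n)⁻¹ * deriv (G n) z, ?_, ?_, ?_⟩
    · filter_upwards [hP, hP0, hG] with n h1 h2 h3
      have h4 : DifferentiableOn ℂ (logDeriv (P n)) U := (h1.deriv hU).div h1 h2
      exact ((h4.div_const _).mul h3).add ((h3.deriv hU).const_mul _)
    · have hcu : TendstoLocallyUniformlyOn (fun n (_ : ℂ) => (c n)⁻¹) (fun _ => 0) atTop U :=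
        (hc.tendstoUniformlyOn_const U).tendstoLocallyUniformlyOn
      have h1 := hlog.mul₀ hGS continuousOn_const hS.continuousOn
      have h2 := hcu.mul₀ hG' continuousOn_const (hS.deriv hU).continuousOn
      refine (h1.add h2).congr_right fun z _ => ?_
      simp
    · filter_upwards [hP, hP0, hG, hGf, hc0] with n h1 h2 h3 h4 h5 z hz
      have hz' := hU.mem_nhds hz
      have hd1 := (h1.differentiableAt hz').hasDerivAt
      have hd2 := (h3.differentiableAt hz').hasDerivAt
      rw [iteratedDeriv_succ, (h4.eventuallyEq_of_mem hz').deriv_eq]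
      refine ((hd1.mul_const (c n ^ k)).mul hd2).deriv.trans ?_
      simp only [logDeriv_apply]
      have := h2 z hz
      field_simp
      ring

/-- A Hurwitz argument without contour integrals: near `z₀` the derivative of `h n` is close to `S'
z₀`, which gives injectivity and simplicity; away from `z₀`, `|S|` is bounded below, which excludes
zeros; a quantitative open mapping theorem gives existence. -/
theorem eventually_existsUnique_simple_zero {U V K : Set ℂ} (hU : IsOpen U) (hV : IsOpen V)
    (hVK : V ⊆ K) (hK : IsCompact K) (hKU : K ⊆ U) {h : ℕ → ℂ → ℂ} {S : ℂ → ℂ}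
    (hh : ∀ᶠ n in atTop, DifferentiableOn ℂ (h n) U)
    (hS : TendstoLocallyUniformlyOn h S atTop U) {z₀ : ℂ} (hz₀ : z₀ ∈ V) (hS0 : S z₀ = 0)
    (hS1 : deriv S z₀ ≠ 0) (huniq : ∀ z ∈ K, S z = 0 → z = z₀) :
    ∀ᶠ n in atTop, ∃ z ∈ V, h n z = 0 ∧ deriv (h n) z ≠ 0 ∧ ∀ w ∈ K, h n w = 0 → w = z := by
  have hSd : DifferentiableOn ℂ S U := hS.differentiableOn hh hU
  have hSc : ContinuousOn S U := hSd.continuousOn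
  set c := deriv S z₀ with hcdef
  have hc : 0 < ‖c‖ := norm_pos_iff.2 hS1
  have hS'c : ContinuousAt (deriv S) z₀ :=
    (hSd.deriv hU).continuousOn.continuousAt (hU.mem_nhds (hKU (hVK hz₀)))
  have hnear : ∀ᶠ z in 𝓝 z₀, z ∈ V ∧ ‖deriv S z - c‖ < ‖c‖ / 4 := by
    refine (hV.eventually_mem hz₀).and ?_
    have := (Metric.tendsto_nhds.1 hS'c) (‖c‖ / 4) (by positivity)
    simpa only [dist_eq_norm] using this
  obtain ⟨r, hr, hball⟩ := Metric.nhds_basis_closedBall.mem_iff.1 hnear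
  have hBV : closedBall z₀ r ⊆ V := fun z hz => (hball hz).1
  have hBK := hBV.trans hVK
  obtain ⟨ε, hε, hεS⟩ : ∃ ε > 0, ∀ z ∈ K \ ball z₀ r, ε ≤ ‖S z‖ := by
    refine (hK.diff isOpen_ball).exists_forall_le' (hSc.norm.mono (sdiff_subset.trans hKU))
      fun z hz => norm_pos_iff.2 fun h0 => hz.2 ?_
    rw [huniq z hz.1 h0]
    exact mem_ball_self hr
  have e1 := (Metric.tendstoUniformlyOn_iff.1
    ((tendstoLocallyUniformlyOn_iff_forall_isCompact hU).1 hS K hKU hK)) (ε / 4) (by positivity)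
  have e2 := (Metric.tendstoUniformlyOn_iff.1
    ((tendstoLocallyUniformlyOn_iff_forall_isCompact hU).1 (hS.deriv hh hU) K hKU hK))
      (‖c‖ / 4) (by positivity)
  filter_upwards [hh, e1, e2] with n hd h1 h2
  simp only [dist_eq_norm, Function.comp_apply] at h1 h2
  have hder : ∀ z ∈ closedBall z₀ r, ‖deriv (h n) z - c‖ ≤ ‖c‖ / 2 := fun z hz => by
    have h3 := h2 z (hBK hz)
    have h4 := (hball hz).2
    rw [norm_sub_rev] at h3
    linarith [norm_sub_le_norm_sub_add_norm_sub (deriv (h n) z) (deriv S z) c]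
  have hinj : ∀ z ∈ closedBall z₀ r, ∀ w ∈ closedBall z₀ r, h n z = h n w → z = w := by
    intro z hz w hw hzw
    -- The perturbation `h n - c z` is Lipschitz with constant `‖c‖ / 2`, too small to cancel `c (w
    -- - z)`.
    have hm := (convex_closedBall z₀ r).norm_image_sub_le_of_norm_hasDerivWithin_le
      (f := fun z => h n z - c * z) (f' := fun z => deriv (h n) z - c)
      (fun x hx => (((hd.differentiableAt (hU.mem_nhds (hKU (hBK hx)))).hasDerivAt.sub
        (by simpa using (hasDerivAt_id x).const_mul c)).hasDerivWithinAt)) hder hz hw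
    have he : h n w - c * w - (h n z - c * z) = -(c * (w - z)) := by rw [hzw]; ring
    rw [he, norm_neg, norm_mul] at hm
    by_contra hne
    have : 0 < ‖w - z‖ := norm_pos_iff.2 (sub_ne_zero.2 (Ne.symm hne))
    nlinarith
  have hmem : ∀ w ∈ K, h n w = 0 → w ∈ ball z₀ r := fun w hw h0 => by
    by_contra hb
    have h3 := h1 w hw
    rw [h0, sub_zero] at h3
    linarith [hεS w ⟨hw, hb⟩]
  have hz₀B : z₀ ∈ closedBall z₀ r := mem_closedBall_self hr.le
  have hval : ‖h n z₀‖ < ε / 4 := by simpa [hS0] using h1 z₀ (hBK hz₀B)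
  have hsph : ∀ z ∈ sphere z₀ r, ε / 2 ≤ ‖h n z - h n z₀‖ := fun z hz => by
    have hzK := hBK (sphere_subset_closedBall hz)
    have h3 := hεS z ⟨hzK, fun hb => (ne_of_lt (mem_ball.1 hb)) (mem_sphere.1 hz)⟩
    have h4 := h1 z hzK
    have h5 := norm_sub_norm_le (S z) (h n z)
    have h6 := norm_sub_norm_le (h n z) (h n z₀)
    linarith
  have hfreq : ∃ᶠ z in 𝓝 z₀, h n z ≠ h n z₀ := by
    have h3 : ∀ᶠ z in 𝓝[≠] z₀, h n z ≠ h n z₀ := by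
      filter_upwards [self_mem_nhdsWithin, nhdsWithin_le_nhds (closedBall_mem_nhds z₀ hr)]
        with z hz hzB heq
      exact hz (hinj z hzB z₀ hz₀B heq)
    exact h3.frequently.filter_mono nhdsWithin_le_nhds
  -- The image of the disc contains the ball of radius `ε / 4` about `h n z₀`, and `‖h n z₀‖ < ε /
  -- 4`.
  have hdc : DiffContOnCl ℂ (h n) (ball z₀ r) :=
    (hd.mono ((closure_ball_subset_closedBall.trans hBK).trans hKU)).diffContOnCl
  obtain ⟨z, hz, hz0⟩ := hdc.ball_subset_image_closedBall hr hsph hfreq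
    (show (0 : ℂ) ∈ ball (h n z₀) (ε / 2 / 2) by
      rw [mem_ball, dist_comm, dist_zero_right]; linarith)
  refine ⟨z, hBV hz, hz0, fun h0 => ?_, fun w hw hw0 =>
    hinj w (ball_subset_closedBall (hmem w hw hw0)) z hz (hw0.trans hz0.symm)⟩
  have := hder z hz
  rw [h0, zero_sub, norm_neg] at this
  linarith

/-! ### The reflection factor: functional equation, recursion in `n`, growth. -/

/-- The nonvanishing factor in the reflected functional equation of `ζ` near `-2n`. -/
noncomputable def reflFactor (n : ℕ) (v : ℂ) : ℂ :=
  (-1) ^ n * 2 * (2 * Real.pi) ^ (v - (2 * n + 1)) * Complex.Gamma (2 * n + 1 - v)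

/-- The negative of the `n`-th harmonic number. -/
noncomputable def negHarmonic (n : ℕ) : ℂ :=
  -((∑ i ∈ Finset.range n, 1 / ((i : ℝ) + 1) : ℝ) : ℂ)

theorem ofReal_two_pi_ne_zero : (2 * Real.pi : ℂ) ≠ 0 := by
  simp [Real.pi_ne_zero]

theorem one_le_re_of_mem_closedBall {n : ℕ} (hn : 1 ≤ n) {v : ℂ} (hv : v ∈ closedBall (0 : ℂ) 2) :
    1 ≤ (2 * (n : ℂ) + 1 - v).re := by
  have h1 := (Complex.re_le_norm v).trans (mem_closedBall_zero_iff.1 hv)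
  have h2 : (1 : ℝ) ≤ n := by exact_mod_cast hn
  simp
  linarith

theorem riemannZeta_neg_two_mul_add {n : ℕ} (hn : 1 ≤ n) {v : ℂ} (hv : v ∈ ball (0 : ℂ) 2) :
    riemannZeta (-2 * n + v) =
      reflFactor n v * (riemannZeta (2 * n + 1 - v) * Complex.sin (Real.pi * v / 2)) := by
  have h1 := (Complex.re_le_norm v).trans_lt (mem_ball_zero_iff.1 hv)
  have h2 : (1 : ℝ) ≤ n := by exact_mod_cast hn
  have h3 : 1 < (2 * (n : ℂ) + 1 - v).re := by simp; linarith
  have hfe := riemannZeta_one_sub (s := 2 * (n : ℂ) + 1 - v) (fun m hm => by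
    rw [hm] at h3
    simp at h3
    have : (0 : ℝ) ≤ m := m.cast_nonneg
    linarith) (fun hm => by rw [hm] at h3; simp at h3)
  have hcos : Complex.cos (Real.pi * (2 * n + 1 - v) / 2) =
      (-1) ^ n * Complex.sin (Real.pi * v / 2) := by
    rw [show (Real.pi * (2 * n + 1 - v) / 2 : ℂ)
      = (Real.pi / 2 - Real.pi * v / 2) + n * Real.pi by ring,
      Complex.cos_antiperiodic.add_nat_mul_eq, Complex.cos_pi_div_two_sub]
  rw [hcos, show 1 - (2 * (n : ℂ) + 1 - v) = -2 * n + v by ring, neg_sub] at hfe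
  rw [hfe, reflFactor]
  ring

theorem differentiableAt_reflFactor_of_re_lt {n : ℕ} (hn : 1 ≤ n) {v : ℂ} (hv : v.re < 3) :
    DifferentiableAt ℂ (reflFactor n) v := by
  have h2 : (1 : ℝ) ≤ n := by exact_mod_cast hn
  have h : 0 < (2 * (n : ℂ) + 1 - v).re := by simp; linarith
  have hG : DifferentiableAt ℂ Complex.Gamma (2 * n + 1 - v) :=
    Complex.differentiableAt_Gamma _ fun m hm => by
      rw [hm] at h
      simp at h
      have : (0 : ℝ) ≤ m := m.cast_nonneg
      linarith
  have hG' : DifferentiableAt ℂ (fun v : ℂ => Complex.Gamma (2 * n + 1 - v)) v :=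
    hG.comp v (by fun_prop)
  have hp : DifferentiableAt ℂ (fun v : ℂ => (2 * Real.pi : ℂ) ^ (v - (2 * n + 1))) v :=
    DifferentiableAt.const_cpow (by fun_prop) (Or.inl ofReal_two_pi_ne_zero)
  exact (hp.const_mul _).mul hG'

theorem re_lt_three_of_mem_closedBall {v : ℂ} (hv : v ∈ closedBall (0 : ℂ) 2) : v.re < 3 :=
  ((Complex.re_le_norm v).trans (mem_closedBall_zero_iff.1 hv)).trans_lt (by norm_num)

theorem differentiableAt_reflFactor {n : ℕ} (hn : 1 ≤ n) {v : ℂ}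
    (hv : v ∈ closedBall (0 : ℂ) 2) : DifferentiableAt ℂ (reflFactor n) v :=
  differentiableAt_reflFactor_of_re_lt hn (re_lt_three_of_mem_closedBall hv)

theorem reflFactor_ne_zero {n : ℕ} (hn : 1 ≤ n) {v : ℂ}
    (hv : v ∈ closedBall (0 : ℂ) 2) : reflFactor n v ≠ 0 := by
  have h := one_le_re_of_mem_closedBall hn hv
  have h1 : Complex.Gamma (2 * n + 1 - v) ≠ 0 :=
    Complex.Gamma_ne_zero_of_re_pos (by linarith)
  have h2 : (2 * Real.pi : ℂ) ^ (v - (2 * n + 1)) ≠ 0 := by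
    simp [Complex.cpow_eq_zero_iff, Real.pi_ne_zero]
  simp [reflFactor, h1, h2]

theorem ne_zero_of_one_le_re {w : ℂ} (hw : 1 ≤ w.re) : w ≠ 0 := by
  rintro rfl
  norm_num at hw

theorem reflFactor_succ {n : ℕ} (hn : 1 ≤ n) {v : ℂ} (hv : v ∈ closedBall (0 : ℂ) 2) :
    reflFactor (n + 1) v =
      -((2 * Real.pi : ℂ) ^ (-2 : ℤ)) * (2 * n + 2 - v) * (2 * n + 1 - v) * reflFactor n v := by
  have h := one_le_re_of_mem_closedBall hn hv
  have h1 : 2 * (n : ℂ) + 1 - v ≠ 0 := ne_zero_of_one_le_re h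
  have h2 : 2 * (n : ℂ) + 2 - v ≠ 0 := ne_zero_of_one_le_re (by simp at h ⊢; linarith)
  have hG : Complex.Gamma (2 * (n + 1 : ℕ) + 1 - v) =
      (2 * n + 2 - v) * ((2 * n + 1 - v) * Complex.Gamma (2 * n + 1 - v)) := by
    rw [← Complex.Gamma_add_one _ h1, show 2 * (n : ℂ) + 1 - v + 1 = 2 * n + 2 - v by ring,
      ← Complex.Gamma_add_one _ h2]
    congr 1
    push_cast
    ring
  have hp : (2 * Real.pi : ℂ) ^ (v - (2 * (n + 1 : ℕ) + 1)) =
      (2 * Real.pi : ℂ) ^ (-2 : ℤ) * (2 * Real.pi : ℂ) ^ (v - (2 * n + 1)) := by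
    rw [← Complex.cpow_intCast, ← Complex.cpow_add _ _ ofReal_two_pi_ne_zero]
    congr 1
    push_cast
    ring
  rw [reflFactor, reflFactor, hG, hp, pow_succ]
  ring

theorem le_norm_two_mul_add_sub (n : ℕ) {v : ℂ} (hv : v ∈ closedBall (0 : ℂ) 2) :
    2 * (n : ℝ) ≤ ‖2 * (n : ℂ) + 2 - v‖ ∧ 2 * (n : ℝ) - 1 ≤ ‖2 * (n : ℂ) + 1 - v‖ := by
  have h1 := (Complex.re_le_norm v).trans (mem_closedBall_zero_iff.1 hv)
  have h2 := Complex.re_le_norm (2 * (n : ℂ) + 2 - v)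
  have h3 := Complex.re_le_norm (2 * (n : ℂ) + 1 - v)
  simp at h2 h3
  constructor <;> linarith

theorem two_mul_norm_reflFactor_le {n : ℕ} (hn : 6 ≤ n) {v : ℂ}
    (hv : v ∈ closedBall (0 : ℂ) 2) : 2 * ‖reflFactor n v‖ ≤ ‖reflFactor (n + 1) v‖ := by
  obtain ⟨h1, h2⟩ := le_norm_two_mul_add_sub n hv
  -- For `n ≥ 6` the two linear factors multiply to at least `12 · 11 = 2 · 66`, and `(2π)² ≤ 66`.
  have hn' : (6 : ℝ) ≤ n := by exact_mod_cast hn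
  rw [reflFactor_succ (by omega) hv, norm_mul, norm_mul, norm_mul, norm_neg, norm_zpow]
  have hpi : ‖(2 * Real.pi : ℂ)‖ = 2 * Real.pi := by
    simp [abs_of_pos Real.pi_pos]
  rw [hpi]
  refine mul_le_mul_of_nonneg_right ?_ (norm_nonneg _)
  have h3 : (12 : ℝ) * 11 ≤ ‖2 * (n : ℂ) + 2 - v‖ * ‖2 * (n : ℂ) + 1 - v‖ :=
    mul_le_mul (by linarith) (by linarith) (by norm_num) (norm_nonneg _)
  have h4 : (2 * Real.pi) ^ 2 ≤ 66 := by nlinarith [Real.pi_lt_d2, Real.pi_pos]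
  have h5 : 0 < (2 * Real.pi) ^ 2 := by positivity
  rw [zpow_neg, mul_assoc, inv_mul_eq_div, le_div_iff₀ (by exact_mod_cast h5)]
  have h6 : (2 * Real.pi) ^ (2 : ℤ) = (2 * Real.pi) ^ 2 := by norm_cast
  rw [h6]
  linarith

theorem exists_pos_mul_two_pow_le_norm_reflFactor :
    ∃ δ > 0, ∀ n ≥ 6, ∀ v ∈ closedBall (0 : ℂ) 2, δ * 2 ^ n ≤ ‖reflFactor n v‖ := by
  obtain ⟨δ, hδ, h⟩ : ∃ δ > 0, ∀ v ∈ closedBall (0 : ℂ) 2, δ ≤ ‖reflFactor 6 v‖ :=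
    (isCompact_closedBall 0 2).exists_forall_le'
      (fun v hv => (differentiableAt_reflFactor (by norm_num)
        hv).continuousAt.continuousWithinAt.norm)
      fun v hv => norm_pos_iff.2 (reflFactor_ne_zero (by norm_num) hv)
  refine ⟨δ / 2 ^ 6, by positivity, fun n hn v hv => ?_⟩
  induction n, hn using Nat.le_induction with
  | base => simpa using h v hv
  | succ n hn ih =>
    rw [pow_succ _ n, ← mul_assoc]
    linarith [two_mul_norm_reflFactor_le hn hv]

/-! ### The logarithmic derivative of the reflection factor against the harmonic numbers. -/

theorem logDeriv_reflFactor_succ {n : ℕ} (hn : 1 ≤ n) {v : ℂ} (hv : v ∈ ball (0 : ℂ) 2) :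
    logDeriv (reflFactor (n + 1)) v =
      logDeriv (reflFactor n) v - 1 / (2 * n + 2 - v) - 1 / (2 * n + 1 - v) := by
  have hv' := ball_subset_closedBall hv
  have h := one_le_re_of_mem_closedBall hn hv'
  have h1 : 2 * (n : ℂ) + 1 - v ≠ 0 := ne_zero_of_one_le_re h
  have h2 : 2 * (n : ℂ) + 2 - v ≠ 0 := ne_zero_of_one_le_re (by simp at h ⊢; linarith)
  have h3 := reflFactor_ne_zero hn hv'
  have hd := (differentiableAt_reflFactor hn hv').hasDerivAt
  have heq : reflFactor (n + 1) =ᶠ[𝓝 v] fun v => -((2 * Real.pi : ℂ) ^ (-2 : ℤ)) *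
      (2 * n + 2 - v) * (2 * n + 1 - v) * reflFactor n v :=
    eventually_of_mem (isOpen_ball.mem_nhds hv) fun w hw =>
      reflFactor_succ hn (ball_subset_closedBall hw)
  have hC : -((2 * Real.pi : ℂ) ^ (-2 : ℤ)) ≠ 0 := neg_ne_zero.2 (zpow_ne_zero _ ofReal_two_pi_ne_zero)
  generalize -((2 * Real.pi : ℂ) ^ (-2 : ℤ)) = C at heq hC
  have hder := ((((hasDerivAt_id v).const_sub (2 * (n : ℂ) + 2)).const_mul C).mul
    ((hasDerivAt_id v).const_sub (2 * (n : ℂ) + 1))).mul hd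
  rw [(logDeriv_congr_nhds heq).eq_of_nhds]
  refine (congrArg (· / _) hder.deriv).trans ?_
  simp only [logDeriv_apply, id_eq, Pi.mul_apply]
  generalize 2 * (n : ℂ) + 1 - v = A at *
  generalize 2 * (n : ℂ) + 2 - v = B at *
  field_simp
  ring

theorem negHarmonic_succ (n : ℕ) : negHarmonic (n + 1) = negHarmonic n - 1 / (n + 1) := by
  simp only [negHarmonic, Finset.sum_range_succ]
  push_cast
  ring

/-- Both `1/(2n+2-v)` and `1/(2n+1-v)` are `1/(2(n+1))` up to `O(1/n²)`. The bound is written in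
telescoping form so that the errors can be summed over `n`. -/
theorem norm_one_div_sub_one_div_sub_one_div_le {n : ℕ} (hn : 1 ≤ n) {v : ℂ} (hv : v ∈ ball (0 : ℂ) 2) :
    ‖(1 / (n + 1) - 1 / (2 * n + 2 - v) - 1 / (2 * n + 1 - v) : ℂ)‖ ≤
      3 * (1 / n - 1 / (n + 1)) := by
  have hv' := ball_subset_closedBall hv
  have h := one_le_re_of_mem_closedBall hn hv'
  have h1 : 2 * (n : ℂ) + 1 - v ≠ 0 := ne_zero_of_one_le_re h
  have h2 : 2 * (n : ℂ) + 2 - v ≠ 0 := ne_zero_of_one_le_re (by simp at h ⊢; linarith)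
  have h0 : (n : ℂ) + 1 ≠ 0 := by exact_mod_cast n.succ_ne_zero
  have hn' : (1 : ℝ) ≤ n := by exact_mod_cast hn
  obtain ⟨b1, b2⟩ := le_norm_two_mul_add_sub n hv'
  have hv2 : ‖v‖ ≤ 2 := mem_closedBall_zero_iff.1 hv'
  have e : (1 / (n + 1) - 1 / (2 * n + 2 - v) - 1 / (2 * n + 1 - v) : ℂ) =
      -v / (2 * (n + 1) * (2 * n + 2 - v)) + (-1 - v) / (2 * (n + 1) * (2 * n + 1 - v)) := by
    obtain ⟨A, hA⟩ : ∃ A, A = 2 * (n : ℂ) + 2 - v := ⟨_, rfl⟩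
    obtain ⟨B, hB⟩ : ∃ B, B = 2 * (n : ℂ) + 1 - v := ⟨_, rfl⟩
    have hv1 : -v = A - 2 * (n + 1) := by rw [hA]; ring
    have hv2 : -1 - v = B - 2 * (n + 1) := by rw [hB]; ring
    rw [← hA] at h2
    rw [← hB] at h1
    rw [hv2, ← hA, ← hB, hv1]
    field_simp
    ring
  have hnn : ‖(n : ℂ) + 1‖ = n + 1 := by
    rw [← Nat.cast_succ, Complex.norm_natCast]; push_cast; ring
  have k1 : ‖-v / (2 * (n + 1) * (2 * n + 2 - v))‖ ≤ 2 / (2 * (n + 1) * n) := by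
    rw [norm_div, norm_mul, norm_mul, hnn, norm_neg, Complex.norm_ofNat]
    gcongr
    linarith
  have k2 : ‖(-1 - v) / (2 * (n + 1) * (2 * n + 1 - v))‖ ≤ 3 / (2 * (n + 1) * n) := by
    rw [norm_div, norm_mul, norm_mul, hnn, Complex.norm_ofNat]
    gcongr
    · refine (norm_sub_le _ _).trans ?_
      rw [norm_neg, norm_one]
      linarith
    · linarith
  rw [e]
  refine (norm_add_le_of_le k1 k2).trans ?_
  rw [div_sub_div _ _ (by positivity) (by positivity), ← add_div, mul_div_assoc',
    div_le_div_iff₀ (by positivity) (by positivity)]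
  nlinarith [mul_nonneg (n.cast_nonneg (α := ℝ)) (n.cast_nonneg (α := ℝ))]

theorem exists_norm_logDeriv_reflFactor_sub_le :
    ∃ M, ∀ n ≥ 1, ∀ v ∈ ball (0 : ℂ) 2, ‖logDeriv (reflFactor n) v - negHarmonic n‖ ≤ M := by
  have hU : IsOpen {v : ℂ | v.re < 3} := isOpen_lt Complex.continuous_re continuous_const
  obtain ⟨M, hM⟩ : ∃ M, ∀ v ∈ closedBall (0 : ℂ) 2,
      ‖logDeriv (reflFactor 1) v - negHarmonic 1‖ ≤ M := by
    refine (isCompact_closedBall 0 2).exists_bound_of_continuousOn fun v hv => ?_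
    have hd : DifferentiableOn ℂ (reflFactor 1) {v : ℂ | v.re < 3} := fun w hw =>
      (differentiableAt_reflFactor_of_re_lt le_rfl hw).differentiableWithinAt
    have ha : AnalyticAt ℂ (reflFactor 1) v :=
      hd.analyticAt (hU.mem_nhds (re_lt_three_of_mem_closedBall hv))
    exact ((ha.deriv.continuousAt.div ha.continuousAt
      (reflFactor_ne_zero le_rfl hv)).sub continuousAt_const).continuousWithinAt
  refine ⟨M + 3, fun n hn v hv => ?_⟩
  -- The strengthened bound carries the telescoped sum `3 (1 - 1/n)` through the induction.
  suffices ‖logDeriv (reflFactor n) v - negHarmonic n‖ ≤ M + 3 * (1 - 1 / n) by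
    have : (0 : ℝ) ≤ 1 / n := by positivity
    linarith
  induction n, hn using Nat.le_induction with
  | base => simpa using hM v (ball_subset_closedBall hv)
  | succ n hn ih =>
    have h := norm_one_div_sub_one_div_sub_one_div_le hn hv
    rw [logDeriv_reflFactor_succ hn hv, negHarmonic_succ]
    calc _ = ‖(logDeriv (reflFactor n) v - negHarmonic n) +
          (1 / (n + 1) - 1 / (2 * n + 2 - v) - 1 / (2 * n + 1 - v) : ℂ)‖ := by
            congr 1; ring
      _ ≤ _ := norm_add_le_of_le ih h
      _ = _ := by push_cast; ring

theorem tendsto_norm_negHarmonic : Tendsto (fun n => ‖negHarmonic n‖) atTop atTop := by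
  refine Real.tendsto_sum_range_one_div_nat_succ_atTop.congr fun n => ?_
  rw [negHarmonic, norm_neg, Complex.norm_real, Real.norm_of_nonneg]
  exact Finset.sum_nonneg fun i _ => by positivity

theorem tendstoLocallyUniformlyOn_logDeriv_reflFactor :
    TendstoLocallyUniformlyOn (fun n v => logDeriv (reflFactor n) v / negHarmonic n) 1 atTop
      (ball 0 2) := by
  refine TendstoUniformlyOn.tendstoLocallyUniformlyOn ?_
  rw [Metric.tendstoUniformlyOn_iff]
  intro ε hε
  obtain ⟨M, hM⟩ := exists_norm_logDeriv_reflFactor_sub_le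
  filter_upwards [eventually_ge_atTop 1, tendsto_norm_negHarmonic.eventually_gt_atTop 0,
    tendsto_norm_negHarmonic.eventually_gt_atTop (M / ε)] with n hn h0 h1 v hv
  have h2 : negHarmonic n ≠ 0 := norm_pos_iff.1 h0
  rw [dist_comm, dist_eq_norm, Pi.one_apply, div_sub_one h2, norm_div, div_lt_iff₀ h0]
  rw [div_lt_iff₀ hε] at h1
  linarith [hM n hn v hv]

/-! ### Uniform limits of the remaining factors. -/

theorem exists_norm_riemannZeta_sub_one_le :
    ∃ C, ∀ w : ℂ, 2 ≤ w.re → ‖riemannZeta w - 1‖ ≤ C * (2 : ℝ) ^ (2 - w.re) := by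
  have hs : Summable fun m : ℕ => 1 / ((m : ℝ) + 2) ^ (2 : ℕ) := by
    simpa using (summable_nat_add_iff 2).2 (Real.summable_one_div_nat_pow.2 one_lt_two)
  refine ⟨∑' m : ℕ, 1 / ((m : ℝ) + 2) ^ (2 : ℕ), fun w hw => ?_⟩
  have hw1 : 1 < w.re := by linarith
  have hsum : Summable fun n : ℕ => 1 / ((n : ℂ) + 1) ^ w := by
    simpa using (summable_nat_add_iff 1).2 (Complex.summable_one_div_nat_cpow.2 hw1)
  rw [zeta_eq_tsum_one_div_nat_add_one_cpow hw1, hsum.tsum_eq_zero_add]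
  simp only [Nat.cast_zero, zero_add, Complex.one_cpow, div_one, add_sub_cancel_left]
  refine tsum_of_norm_bounded (hs.hasSum.mul_right _) fun m => ?_
  have hm : (0 : ℝ) < (m : ℝ) + 2 := by positivity
  have e : (((m + 1 : ℕ) : ℂ) + 1) = (((m : ℝ) + 2 : ℝ) : ℂ) := by push_cast; ring
  rw [e, norm_div, norm_one, Complex.norm_cpow_eq_rpow_re_of_pos hm,
    show w.re = 2 + (w.re - 2) by ring, Real.rpow_add hm, Real.rpow_two, one_div, mul_inv, one_div]
  gcongr
  -- Only two powers of `m + 2` are kept for summability; the rest are bounded using `m + 2 ≥ 2`.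
  rw [show 2 - (2 + (w.re - 2)) = -(w.re - 2) by ring, Real.rpow_neg zero_le_two]
  gcongr
  · linarith

theorem tendstoLocallyUniformlyOn_riemannZeta_reflected :
    TendstoLocallyUniformlyOn (fun (n : ℕ) (v : ℂ) => riemannZeta (2 * n + 1 - v)) 1 atTop
      (ball 0 2) := by
  refine TendstoUniformlyOn.tendstoLocallyUniformlyOn ?_
  rw [Metric.tendstoUniformlyOn_iff]
  intro ε hε
  obtain ⟨C, hC⟩ := exists_norm_riemannZeta_sub_one_le
  have ht : Tendsto (fun n : ℕ => |C| * (1 / 2 : ℝ) ^ n) atTop (𝓝 0) := by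
    simpa using (tendsto_pow_atTop_nhds_zero_of_lt_one (by norm_num : (0 : ℝ) ≤ 1 / 2)
      (by norm_num)).const_mul |C|
  filter_upwards [eventually_ge_atTop 3, ht.eventually_lt_const hε] with n hn h1 v hv
  have h2 := (Complex.re_le_norm v).trans_lt (mem_ball_zero_iff.1 hv)
  have hn' : (3 : ℝ) ≤ n := by exact_mod_cast hn
  have hre : (n : ℝ) + 2 ≤ (2 * (n : ℂ) + 1 - v).re := by simp; linarith
  rw [dist_comm, dist_eq_norm]
  refine ((hC _ (by linarith)).trans ?_).trans_lt h1
  refine (mul_le_mul_of_nonneg_right (le_abs_self C) (by positivity)).trans ?_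
  gcongr
  calc (2 : ℝ) ^ (2 - (2 * (n : ℂ) + 1 - v).re) ≤ 2 ^ (-(n : ℝ)) :=
        Real.rpow_le_rpow_of_exponent_le one_le_two (by linarith)
    _ = (1 / 2) ^ n := by
        rw [Real.rpow_neg zero_le_two, Real.rpow_natCast, one_div, inv_pow]

theorem tendstoLocallyUniformlyOn_const_div_reflFactor_mul_pow (a : ℂ) (k : ℕ) :
    TendstoLocallyUniformlyOn (fun n v => a / (reflFactor n v * negHarmonic n ^ k)) 0 atTop
      (ball 0 2) := by
  refine TendstoUniformlyOn.tendstoLocallyUniformlyOn ?_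
  rw [Metric.tendstoUniformlyOn_iff]
  intro ε hε
  obtain ⟨δ, hδ, h⟩ := exists_pos_mul_two_pow_le_norm_reflFactor
  have ht : Tendsto (fun n : ℕ => δ * 2 ^ n) atTop atTop :=
    (tendsto_pow_atTop_atTop_of_one_lt one_lt_two).const_mul_atTop hδ
  filter_upwards [eventually_ge_atTop 6, tendsto_norm_negHarmonic.eventually_ge_atTop 1,
    ht.eventually_gt_atTop (‖a‖ / ε)] with n hn h1 h2 v hv
  have h3 := h n hn v (ball_subset_closedBall hv)
  have h4 : 0 < δ * 2 ^ n := by positivity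
  have h5 : 1 ≤ ‖negHarmonic n‖ ^ k := one_le_pow₀ h1
  have h6 : δ * 2 ^ n ≤ ‖reflFactor n v‖ * ‖negHarmonic n‖ ^ k :=
    h3.trans (le_mul_of_one_le_right (norm_nonneg _) h5)
  rw [dist_comm, Pi.zero_apply, dist_zero_right, norm_div, norm_mul, norm_pow,
    div_lt_iff₀ (h4.trans_le h6)]
  rw [div_lt_iff₀ hε] at h2
  nlinarith

theorem differentiableOn_riemannZeta_reflected {n : ℕ} (hn : 1 ≤ n) :
    DifferentiableOn ℂ (fun v : ℂ => riemannZeta (2 * n + 1 - v)) (ball 0 2) := fun v hv => by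
  have h2 := (Complex.re_le_norm v).trans_lt (mem_ball_zero_iff.1 hv)
  have hn' : (1 : ℝ) ≤ n := by exact_mod_cast hn
  have h : DifferentiableAt ℂ riemannZeta (2 * n + 1 - v) := differentiableAt_riemannZeta fun h => by
    have := congrArg Complex.re h
    simp at this
    linarith
  exact (h.comp v (f := fun v : ℂ => 2 * (n : ℂ) + 1 - v) (by fun_prop)).differentiableWithinAt

/-! ### The square, the factorization of `ζ^(k) - a`, and the conclusion. -/

theorem sin_pi_mul_div_two_eq_zero {z : ℂ} (hz : |z.re| ≤ 1)
    (h : Complex.sin (Real.pi * z / 2) = 0) : z = 0 := by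
  obtain ⟨m, hm⟩ := Complex.sin_eq_zero_iff.1 h
  have hz' : z = 2 * m := by
    have : (Real.pi : ℂ) ≠ 0 := by simp [Real.pi_ne_zero]
    field_simp at hm
    linear_combination hm
  have hre : z.re = 2 * m := by simp [hz']
  rw [hre, abs_le] at hz
  have h1 : m = 0 := by
    have h2 : (-1 : ℝ) < m := by linarith
    have h3 : (m : ℝ) < 1 := by linarith
    norm_cast at h2 h3
    omega
  simp [hz', h1]

theorem closedBox_subset_ball : Icc (-1 : ℝ) 1 ×ℂ Icc (-1 : ℝ) 1 ⊆ ball 0 2 := fun z hz => by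
  obtain ⟨h1, h2⟩ := Complex.mem_reProdIm.1 hz
  rw [mem_ball_zero_iff, ← abs_of_nonneg (norm_nonneg z), ← abs_of_pos (two_pos : (0 : ℝ) < 2),
    ← sq_lt_sq, ← Complex.normSq_eq_norm_sq, Complex.normSq_apply]
  nlinarith [h1.1, h1.2, h2.1, h2.2]

theorem add_mem_zetaBox_iff {n : ℕ} {v : ℂ} :
    -2 * n + v ∈ zetaBox n ↔ v ∈ Ioo (-1 : ℝ) 1 ×ℂ Ioo (-1 : ℝ) 1 := by
  simp only [zetaBox, mem_ofPred_eq, Complex.mem_reProdIm, mem_Ioo]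
  simp only [Complex.add_re, Complex.add_im, Complex.mul_re, Complex.mul_im, Complex.neg_re,
    Complex.neg_im, Complex.re_ofNat, Complex.im_ofNat, Complex.natCast_re, Complex.natCast_im]
  constructor
  · rintro ⟨h1, h2, h3, h4⟩
    refine ⟨⟨?_, ?_⟩, ?_, ?_⟩ <;> linarith
  · rintro ⟨⟨h1, h2⟩, h3, h4⟩
    refine ⟨?_, ?_, ?_, ?_⟩ <;> linarith

theorem analyticAt_zetaDeriv {k : ℕ} {s : ℂ} (hs : s ≠ 1) : AnalyticAt ℂ (zetaDeriv k) s := by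
  have h : DifferentiableOn ℂ riemannZeta {1}ᶜ := fun z hz =>
    (differentiableAt_riemannZeta hz).differentiableWithinAt
  rw [zetaDeriv, iteratedDeriv_eq_iterate]
  exact (h.analyticAt (isOpen_compl_singleton.mem_nhds hs)).iterated_deriv k

/-- For all large `n`, near `-2n`, the function `ζ^{(k)} - a` is a nonvanishing holomorphic factor
times a function close to `sin (π v / 2)`. -/
theorem exists_zetaDeriv_sub_factorization (k : ℕ) (a : ℂ) :
    ∃ h : ℕ → ℂ → ℂ, (∀ᶠ n in atTop, DifferentiableOn ℂ (h n) (ball 0 2)) ∧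
      TendstoLocallyUniformlyOn h (fun v => Complex.sin (Real.pi * v / 2)) atTop (ball 0 2) ∧
      ∀ᶠ n : ℕ in atTop, ∀ v ∈ ball (0 : ℂ) 2, zetaDeriv k (-2 * n + v) - a =
        reflFactor n v * negHarmonic n ^ k * h n v := by
  have hP : ∀ᶠ n in atTop, DifferentiableOn ℂ (reflFactor n) (ball 0 2) := by
    filter_upwards [eventually_ge_atTop 1] with n hn v hv
    exact (differentiableAt_reflFactor hn (ball_subset_closedBall hv)).differentiableWithinAt
  have hP0 : ∀ᶠ n in atTop, ∀ v ∈ ball (0 : ℂ) 2, reflFactor n v ≠ 0 := by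
    filter_upwards [eventually_ge_atTop 1] with n hn v hv
    exact reflFactor_ne_zero hn (ball_subset_closedBall hv)
  have hc0 : ∀ᶠ n in atTop, negHarmonic n ≠ 0 := by
    filter_upwards [tendsto_norm_negHarmonic.eventually_gt_atTop 0] with n hn
    exact norm_pos_iff.1 hn
  have hc : Tendsto (fun n => (negHarmonic n)⁻¹) atTop (𝓝 0) :=
    tendsto_inv₀_cobounded.comp (tendsto_norm_atTop_iff_cobounded.1 tendsto_norm_negHarmonic)
  have hsin : Differentiable ℂ fun v : ℂ => Complex.sin (Real.pi * v / 2) := by fun_prop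
  have hsinT : TendstoLocallyUniformlyOn (fun (_ : ℕ) v => Complex.sin (Real.pi * v / 2))
      (fun v => Complex.sin (Real.pi * v / 2)) atTop (ball 0 2) :=
    fun u hu _ _ => ⟨univ, univ_mem, Eventually.of_forall fun _ _ _ => refl_mem_uniformity hu⟩
  have hgS : TendstoLocallyUniformlyOn
      (fun (n : ℕ) (v : ℂ) => riemannZeta (2 * n + 1 - v) * Complex.sin (Real.pi * v / 2))
      (fun v => Complex.sin (Real.pi * v / 2)) atTop (ball 0 2) :=
    (tendstoLocallyUniformlyOn_riemannZeta_reflected.mul₀ hsinT continuousOn_const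
      hsin.continuous.continuousOn).congr_right fun v _ => by simp
  obtain ⟨G, hG, hGS, hGf⟩ := exists_iteratedDeriv_eq_mul_pow_mul isOpen_ball
    (f := fun (n : ℕ) v => riemannZeta (-2 * n + v)) hP hP0 hc hc0
    tendstoLocallyUniformlyOn_logDeriv_reflFactor
    ((eventually_ge_atTop 1).mono fun n hn v hv => riemannZeta_neg_two_mul_add hn hv)
    ((eventually_ge_atTop 1).mono fun n hn =>
      (differentiableOn_riemannZeta_reflected hn).mul hsin.differentiableOn) hgS k
  refine ⟨fun n v => G n v - a / (reflFactor n v * negHarmonic n ^ k), ?_, ?_, ?_⟩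
  · filter_upwards [hP, hP0, hc0, hG] with n h1 h2 h3 h4
    exact h4.sub ((differentiableOn_const a).div (h1.mul_const _)
      fun v hv => mul_ne_zero (h2 v hv) (pow_ne_zero _ h3))
  · exact (hGS.sub (tendstoLocallyUniformlyOn_const_div_reflFactor_mul_pow a k)).congr_right
      fun v _ => by simp
  · filter_upwards [hP0, hc0, hGf] with n h1 h2 h3 v hv
    have h4 := h3 hv
    rw [iteratedDeriv_comp_const_add] at h4
    have h5 := h1 v hv
    change zetaDeriv k (-2 * n + v) = _ at h4
    rw [h4]
    field_simp

theorem theorem2p2 (k : ℕ) (hk : 1 ≤ k) (a : ℂ) :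
    ∃ N : ℕ, 0 < N ∧ ∀ n : ℕ, N ≤ n → HasExactlyOneRoot (zetaDeriv k) a (zetaBox n) := by
  obtain ⟨h, hd, hS, heq⟩ := exists_zetaDeriv_sub_factorization k a
  have hderiv : deriv (fun v : ℂ => Complex.sin (Real.pi * v / 2)) 0 ≠ 0 := by
    have : HasDerivAt (fun v : ℂ => Complex.sin (Real.pi * v / 2)) (Real.pi / 2) 0 := by
      simpa using (((hasDerivAt_id (0 : ℂ)).const_mul (Real.pi : ℂ)).div_const 2).csin
    rw [this.deriv]
    simp [Real.pi_ne_zero]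
  -- The root is located in the open square; uniqueness is obtained on its compact closure.
  have hroot := eventually_existsUnique_simple_zero isOpen_ball
    (isOpen_Ioo.reProdIm isOpen_Ioo : IsOpen (Ioo (-1 : ℝ) 1 ×ℂ Ioo (-1 : ℝ) 1))
    (Complex.reProdIm_subset_iff.2 (prod_mono Ioo_subset_Icc_self Ioo_subset_Icc_self))
    (isCompact_Icc.reProdIm isCompact_Icc) closedBox_subset_ball hd hS
    (z₀ := 0) (by simp [Complex.mem_reProdIm]) (by simp) hderiv
    fun z hz => sin_pi_mul_div_two_eq_zero (abs_le.2 (Complex.mem_reProdIm.1 hz).1)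
  obtain ⟨N, hN⟩ := eventually_atTop.1 ((hroot.and (hd.and heq)).and
    (tendsto_norm_negHarmonic.eventually_gt_atTop 0))
  refine ⟨N + 1, N.succ_pos, fun n hn => ?_⟩
  obtain ⟨⟨⟨v, hv, hv0, hv1, huniq⟩, hdn, hfac⟩, hc⟩ := hN n (by omega)
  have hsub : Ioo (-1 : ℝ) 1 ×ℂ Ioo (-1 : ℝ) 1 ⊆ Icc (-1 : ℝ) 1 ×ℂ Icc (-1 : ℝ) 1 :=
    Complex.reProdIm_subset_iff.2 (prod_mono Ioo_subset_Icc_self Ioo_subset_Icc_self)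
  have hA0 : ∀ w ∈ ball (0 : ℂ) 2, reflFactor n w * negHarmonic n ^ k ≠ 0 := fun w hw =>
    mul_ne_zero (reflFactor_ne_zero (by omega) (ball_subset_closedBall hw))
      (pow_ne_zero _ (norm_pos_iff.1 hc))
  have hvB := closedBox_subset_ball (hsub hv)
  have hroot : zetaDeriv k (-2 * n + v) = a := sub_eq_zero.1 (by rw [hfac v hvB, hv0, mul_zero])
  have hne : (-2 * (n : ℂ) + v) ≠ 1 := fun h1 => by
    have h2 := congrArg Complex.re h1
    have h3 := (Complex.mem_reProdIm.1 hv).1.2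
    have h4 : (1 : ℝ) ≤ n := by exact_mod_cast (by omega : 1 ≤ n)
    simp at h2
    linarith
  have han := analyticAt_zetaDeriv (k := k) hne
  refine ⟨-2 * n + v, add_mem_zetaBox_iff.2 hv, hroot, han, ?_, fun z hz hza => ?_⟩
  · have hD : deriv (zetaDeriv k) (-2 * n + v) ≠ 0 := by
      have h1 : deriv (fun w => zetaDeriv k (-2 * n + w) - a) v =
          deriv (zetaDeriv k) (-2 * n + v) := by
        rw [deriv_sub_const, deriv_comp_const_add]
      have hnhds := isOpen_ball.mem_nhds hvB
      -- At a zero of `h n` the product rule leaves only the zero-free factor times `deriv (h n) v`.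
      have h2 := ((((differentiableAt_reflFactor (by omega : 1 ≤ n)
        (ball_subset_closedBall hvB)).mul_const (negHarmonic n ^ k)).hasDerivAt).mul
        (hdn.differentiableAt hnhds).hasDerivAt).deriv
      rw [← h1, (EqOn.eventuallyEq_of_mem (s := ball 0 2) hfac hnhds).deriv_eq]
      refine ne_of_eq_of_ne h2 ?_
      simpa [hv0] using ⟨by simpa using hA0 v hvB, hv1⟩
    simpa only [hroot] using han.analyticOrderAt_sub_eq_one_of_deriv_ne_zero hD
  · obtain ⟨w, rfl⟩ : ∃ w, z = -2 * n + w := ⟨z + 2 * n, by ring⟩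
    have hw := add_mem_zetaBox_iff.1 hz
    have hwB := closedBox_subset_ball (hsub hw)
    have h1 := hfac w hwB
    rw [hza, sub_self] at h1
    rw [huniq w (hsub hw) ((mul_eq_zero.1 h1.symm).resolve_left (hA0 w hwB))]
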